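/- Theorem 6.3 (Jacobi–Trudi expansion for wave Schur functions). Let $x_1,x_2,\dots$ be commuting variables. A composition of an integer $m\ge 1$ is a sequence $\alpha=(\alpha_1,\dots,\alpha_k)$ of positive integers with sum $m$; put $D(\alpha)=\{\alpha_1,\alpha_1+\alpha_2,\dots,\alpha_1+\cdots+\alpha_{k-1}\}$. The map $D$ is a bijection from the compositions of $m$ to the subsets of $\{1,\dots,m-1\}$; let $\mathcal C$ be its inverse. Let $M_\alpha=\sum_{i_1<\cdots<i_k}x_{i_1}^{\alpha_1}\cdots x_{i_k}^{\alpha_k}$ and let $L_\alpha=\sum_{\beta} M_\beta$, the sum being over the compositions $\beta$ of $m$ with $D(\alpha)\subseteq D(\beta)$ (the fundamental quasi-symmetric function). Moreover put $L_{(0)}=1$ and $L_\emptyset=0$. Let $\mathbf p=(p_a)_{a\in\mathbb Z}$ be any sequence with $p_a\in\{\mathrm{weak},\mathrm{strict}\}$, and let $\overline{\mathrm{weak}}=\mathrm{strict}$, $\overline{\mathrm{strict}}=\mathrm{weak}$. Let $\mu\subseteq\lambda$ be partitions, and let $\lambda/\mu=\{(i,j) : i\ge 1,\ \mu_i<j\le\lambda_i\}$.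 A wave $\mathbf p$-tableau of shape $\lambda/\mu$ is a map $T:\lambda/\mu\to\{1,2,\dots\}$ such that - whenever $(i,j-1)$ and $(i,j)$ lie in $\lambda/\mu$: $T(i,j-1)\le T(i,j)$ if $p_{j-i}=\mathrm{weak}$, and $T(i,j-1)<T(i,j)$ if $p_{j-i}=\mathrm{strict}$; - whenever $(i-1,j)$ and $(i,j)$ lie in $\lambda/\mu$: $T(i-1,j)\le T(i,j)$ if $\overline{p_{j-i+1}}=\mathrm{weak}$, and $T(i-1,j)<T(i,j)$ if $\overline{p_{j-i+1}}=\mathrm{strict}$. The wave Schur function is $s^{\mathbf p}_{\lambda/\mu}=\sum_T\prod_{k\ge1}x_k^{\#T^{-1}(k)}\in\mathbb Z[[x_1,x_2,\dots]]$, the sum being over all wave $\mathbf p$-tableaux $T$ of shape $\lambda/\mu$. Let $n$ be the number of rows of $\lambda$. For $1\le i,j\le n$ define $\alpha_{ij}=\alpha_{ij}(\lambda,\mu)$ as follows. If $\mu_j-j+1<\lambda_i-i$, let $$D_{ij}=\{a-(\mu_j-j+1) : \mu_j-j+1<a\le\lambda_i-i,\ p_a=\mathrm{strict}\}$$ and let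 $\alpha_{ij}=\mathcal C(D_{ij})$, a composition of $\lambda_i-\mu_j-i+j$. If $\mu_j-j+1=\lambda_i-i$, let $\alpha_{ij}=(1)$; if $\mu_j-j=\lambda_i-i$, let $\alpha_{ij}=(0)$; if $\mu_j-j>\lambda_i-i$, let $\alpha_{ij}=\emptyset$. Then $$s^{\mathbf p}_{\lambda/\mu}=\det\bigl(L_{\alpha_{ij}(\lambda,\mu)}\bigr)_{i,j=1}^n .$$ -/

import Mathlib

/-- The two kinds of edges: along a weak edge a tableau increases weakly, along a strict edge
it increases strictly. -/
inductive StrictWeak where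
  | weak : StrictWeak
  | strict : StrictWeak
deriving DecidableEq

namespace StrictWeak

/-- The involution exchanging `weak` and `strict`. -/
def bar : StrictWeak → StrictWeak
  | weak => strict
  | strict => weak

/-- The relation on values demanded by an edge: `≤` for a weak edge, `<` for a strict edge. -/
def Rel : StrictWeak → ℕ+ → ℕ+ → Prop
  | weak, a, b => a ≤ b
  | strict, a, b => a < b

end StrictWeak

namespace WaveSchur

/-! ### Fundamental quasi-symmetric functions

The variables are `x_1, x_2, …`, indexed by the positive integers; power series have integer
coefficients. -/

/-- The increasing sequences `i_1 < ⋯ < i_k` with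
`x_{i_1}^{α_1} ⋯ x_{i_k}^{α_k} = x^d`, where `α = (α_1, …, α_k)`. -/
abbrev MonomialSeq {n : ℕ} (α : Composition n) (d : ℕ+ →₀ ℕ) : Type :=
  {i : Fin α.length ↪o ℕ+ // ∑ r, Finsupp.single (i r) (α.blocksFun r) = d}

/-- The monomial quasi-symmetric function
`M_α = ∑_{i_1 < ⋯ < i_k} x_{i_1}^{α_1} ⋯ x_{i_k}^{α_k}`. -/
noncomputable def monomialQSym {n : ℕ} (α : Composition n) : MvPowerSeries ℕ+ ℤ :=
  fun d => (Nat.card (MonomialSeq α d) : ℤ)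

/-- The set `D(α) = {α_1, α_1 + α_2, …, α_1 + ⋯ + α_{k-1}}` of a composition
`α = (α_1, …, α_k)`. -/
def descentSet {n : ℕ} (α : Composition n) : Finset ℕ :=
  (Finset.Ioo 0 α.length).image α.sizeUpTo

/-- The fundamental quasi-symmetric function `L_α = ∑ M_β`, the sum being over the compositions
`β` of `n = |α|` with `D(α) ⊆ D(β)`. -/
noncomputable def fundamentalQSym {n : ℕ} (α : Composition n) : MvPowerSeries ℕ+ ℤ :=
  ∑ β : Composition n with descentSet α ⊆ descentSet β, monomialQSym β

/-- The composition `C(D)` of `n` attached to a set `D ⊆ {1, …, n - 1}`: its blocks are the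
intervals into which `D` cuts `{1, …, n}`. It is characterised by `D(C(D)) = D`, see
`descentSet_compositionOfSet`. -/
def compositionOfSet (n : ℕ) (D : Finset ℕ) : Composition n :=
  CompositionAsSet.toComposition
    { boundaries := Finset.univ.filter fun a : Fin n.succ =>
        a = 0 ∨ a = Fin.last n ∨ (a : ℕ) ∈ D
      zero_mem := by simp
      getLast_mem := by simp }

lemma mem_descentSet {n : ℕ} (α : Composition n) (a : ℕ) :
    a ∈ descentSet α ↔ 0 < a ∧ a < n ∧ ∃ b ∈ α.boundaries, (b : ℕ) = a := by
  have hval : ∀ i : Fin (α.length + 1), (α.boundary i : ℕ) = α.sizeUpTo i := fun i => rfl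
  simp only [descentSet, Finset.mem_image, Finset.mem_Ioo, Composition.boundaries,
    Finset.mem_map, Finset.mem_univ, true_and]
  constructor
  · rintro ⟨r, ⟨h0, h1⟩, rfl⟩
    have hs : StrictMono α.boundary := α.boundary.strictMono
    have a0 : α.boundary 0 < α.boundary ⟨r, by omega⟩ := hs (by simpa [Fin.lt_def] using h0)
    have a1 : α.boundary ⟨r, by omega⟩ < α.boundary (Fin.last _) :=
      hs (by simpa [Fin.lt_def] using h1)
    rw [Composition.boundary_zero, Fin.lt_def, hval] at a0
    rw [Composition.boundary_last, Fin.lt_def, hval] at a1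
    exact ⟨by simpa using a0, by simpa using a1, _, ⟨⟨r, by omega⟩, rfl⟩, rfl⟩
  · rintro ⟨h0, h1, b, ⟨r, rfl⟩, rfl⟩
    refine ⟨r, ⟨?_, ?_⟩, rfl⟩
    · rcases Nat.eq_zero_or_pos (r : ℕ) with h | h
      · exfalso
        change 0 < α.sizeUpTo r at h0
        simp [h] at h0
      · exact h
    · by_contra h
      have h2 : (α.boundary r : ℕ) = n := α.sizeUpTo_ofLength_le _ (by omega)
      exact absurd h2 (Nat.ne_of_lt h1)

/-- `compositionOfSet n` inverts `descentSet` on the subsets of `{1, …, n - 1}`. -/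
theorem descentSet_compositionOfSet {n : ℕ} {D : Finset ℕ} (hD : ∀ a ∈ D, 0 < a ∧ a < n) :
    descentSet (compositionOfSet n D) = D := by
  ext a
  rw [mem_descentSet, compositionOfSet, CompositionAsSet.toComposition_boundaries]
  simp only [Finset.mem_filter, Finset.mem_univ, true_and]
  constructor
  · rintro ⟨h0, h1, b, hb | hb | hb, rfl⟩
    · simp [hb] at h0
    · simp [hb] at h1
    · exact hb
  · intro ha
    obtain ⟨h0, h1⟩ := hD a ha
    exact ⟨h0, h1, ⟨a, by omega⟩, Or.inr (Or.inr ha), rfl⟩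

/-- The fundamental quasi-symmetric function of the composition of `0` is `1`. -/
theorem fundamentalQSym_zero (α : Composition 0) : fundamentalQSym α = 1 := by
  have hlen : ∀ β : Composition 0, β.length = 0 := fun β => by simp
  have hd : ∀ β : Composition 0, descentSet β = ∅ := fun β => by
    simp [descentSet]
  have hsub : ∀ β : Composition 0, β = α := fun β => Composition.ext (by
    rw [(Composition.blocks_eq_nil β).2 rfl, (Composition.blocks_eq_nil α).2 rfl])
  have hu : (Finset.univ.filter fun β : Composition 0 => descentSet α ⊆ descentSet β) = {α} := by
    ext β
    simp [hd, hsub β]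
  rw [fundamentalQSym, hu, Finset.sum_singleton]
  ext d
  rw [MvPowerSeries.coeff_one]
  change (Nat.card (MonomialSeq α d) : ℤ) = _
  have he : IsEmpty (Fin α.length) := by rw [hlen]; infer_instance
  split_ifs with h
  · have : Unique (MonomialSeq α d) :=
      { default := ⟨OrderEmbedding.ofIsEmpty, by simp [h]⟩
        uniq := fun x => Subtype.ext (by ext r; exact he.elim r) }
    simp
  · have : IsEmpty (MonomialSeq α d) := ⟨fun x => h (by rw [← x.2]; simp)⟩
    simp

/-! ### Wave Schur functions

Boxes are pairs `(i, j)` of a row index and a column index. Rows and columns are counted from `0`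
as usual for `YoungDiagram`; this shift does not change the content `j - i` of a box. -/

/-- The edge-labeling `O_p` of the covers `s ⋖ t` of the quadrant `ℕ × ℕ`: for `t = (i, j)`, the
label is `p_{j-i}` when `s = (i, j-1)`, and the opposite of `p_{j-i+1}` when `s = (i-1, j)`. -/
def edgeLabel (p : ℤ → StrictWeak) (s t : ℕ × ℕ) : StrictWeak :=
  if s.1 = t.1 then p ((t.2 : ℤ) - t.1) else (p ((t.2 : ℤ) - t.1 + 1)).bar

/-- The boxes of the skew shape `lam/mu`. -/
def skewCells (lam mu : YoungDiagram) : Finset (ℕ × ℕ) :=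
  lam.cells \ mu.cells

/-- `T` is a wave `p`-tableau of shape `lam/mu`. -/
def IsWaveTableau (p : ℤ → StrictWeak) (lam mu : YoungDiagram)
    (T : skewCells lam mu → ℕ+) : Prop :=
  ∀ s t : skewCells lam mu, (s : ℕ × ℕ) ⋖ (t : ℕ × ℕ) →
    (edgeLabel p s t).Rel (T s) (T t)

/-- The weight of `T`: the exponent vector `k ↦ #T⁻¹(k)`. -/
noncomputable def tableauWeight {lam mu : YoungDiagram} (T : skewCells lam mu → ℕ+) : ℕ+ →₀ ℕ :=
  ∑ s, Finsupp.single (T s) 1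

/-- The wave `p`-tableaux of shape `lam/mu` and weight `d`. -/
abbrev WaveTableau (p : ℤ → StrictWeak) (lam mu : YoungDiagram) (d : ℕ+ →₀ ℕ) : Type :=
  {T : skewCells lam mu → ℕ+ // IsWaveTableau p lam mu T ∧ tableauWeight T = d}

/-- The wave Schur function `s^p_{lam/mu} = ∑_T ∏_k x_k ^ #T⁻¹(k)`, the sum being over the wave
`p`-tableaux of shape `lam/mu`: the coefficient at `x^d` is the number of tableaux of
weight `d`. -/
noncomputable def waveSchur (p : ℤ → StrictWeak) (lam mu : YoungDiagram) : MvPowerSeries ℕ+ ℤ :=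
  fun d => (Nat.card (WaveTableau p lam mu d) : ℤ)

theorem tableauWeight_apply {lam mu : YoungDiagram} (T : skewCells lam mu → ℕ+) (k : ℕ+) :
    tableauWeight T k = (Finset.univ.filter fun s => T s = k).card := by
  rw [tableauWeight, Finsupp.finsetSum_apply, Finset.card_filter]
  exact Finset.sum_congr rfl fun s _ => Finsupp.single_apply

/-- There are finitely many tableaux of each weight, so `Nat.card` really counts them. -/
instance finite_waveTableau (p : ℤ → StrictWeak) (lam mu : YoungDiagram) (d : ℕ+ →₀ ℕ) :
    Finite (WaveTableau p lam mu d) := by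
  have key : ∀ (T : WaveTableau p lam mu d) (s), T.1 s ∈ d.support := fun T s => by
    rw [Finsupp.mem_support_iff, ← congrFun (congrArg DFunLike.coe T.2.2) (T.1 s),
      tableauWeight_apply]
    exact Finset.card_ne_zero.2 ⟨s, by simp⟩
  refine Finite.of_injective
    (fun T : WaveTableau p lam mu d => fun s => (⟨T.1 s, key T s⟩ : d.support)) ?_
  intro T T' h
  refine Subtype.ext (funext fun s => ?_)
  simpa using congrFun h s

/-- There are finitely many monomials of `M_α` equal to `x^d`. -/
instance finite_monomialSeq {n : ℕ} (α : Composition n) (d : ℕ+ →₀ ℕ) :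
    Finite (MonomialSeq α d) := by
  have key : ∀ (i : MonomialSeq α d) (r), i.1 r ∈ d.support := fun i r => by
    rw [Finsupp.mem_support_iff, ← congrFun (congrArg DFunLike.coe i.2) (i.1 r),
      Finsupp.finsetSum_apply]
    have h1 : Finsupp.single (i.1 r) (α.blocksFun r) (i.1 r) ≤
        ∑ r', Finsupp.single (i.1 r') (α.blocksFun r') (i.1 r) :=
      Finset.single_le_sum (f := fun r' => Finsupp.single (i.1 r') (α.blocksFun r') (i.1 r))
        (fun _ _ => Nat.zero_le _) (Finset.mem_univ r)
    have h2 := α.one_le_blocksFun r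
    rw [Finsupp.single_eq_same] at h1
    omega
  refine Finite.of_injective
    (fun i : MonomialSeq α d => fun r => (⟨i.1 r, key i r⟩ : d.support)) ?_
  intro i i' h
  refine Subtype.ext (RelEmbedding.ext fun r => ?_)
  simpa using congrFun h r

/-! ### The entries of the determinant

With rows counted from `1`, the number `mu_j - j + 1` of the usual notation is `rowStart mu j`
and `lam_i - i` is `rowStop lam i`, for the rows counted from `0`. -/

/-- `mu_j - j + 1` for the row `j + 1` of `mu`, that is, the row with index `j` from `0`. -/
def rowStart (mu : YoungDiagram) (j : ℕ) : ℤ :=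
  (mu.rowLen j : ℤ) - ((j : ℤ) + 1) + 1

/-- `lam_i - i` for the row `i + 1` of `lam`, that is, the row with index `i` from `0`. -/
def rowStop (lam : YoungDiagram) (i : ℕ) : ℤ :=
  (lam.rowLen i : ℤ) - ((i : ℤ) + 1)

/-- The size `lam_i - mu_j - i + j` of the composition `α_{ij}`; it is used only when this integer
is non-negative. -/
def entrySize (lam mu : YoungDiagram) (i j : ℕ) : ℕ :=
  (rowStop lam i - rowStart mu j + 1).toNat

/-- `D_{ij} = {mu_j - j + 1 < a ≤ lam_i - i | p_a = strict} - (mu_j - j + 1)`. -/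
noncomputable def entryDescents (p : ℤ → StrictWeak) (lam mu : YoungDiagram) (i j : ℕ) : Finset ℕ :=
  ((Finset.Ioc (rowStart mu j) (rowStop lam i)).filter fun a => p a = StrictWeak.strict).image
    fun a => (a - rowStart mu j).toNat

theorem entryDescents_bounds (p : ℤ → StrictWeak) (lam mu : YoungDiagram) (i j : ℕ) :
    ∀ a ∈ entryDescents p lam mu i j, 0 < a ∧ a < entrySize lam mu i j := by
  intro a ha
  simp only [entryDescents, Finset.mem_image, Finset.mem_filter, Finset.mem_Ioc] at ha
  obtain ⟨b, ⟨⟨h1, h2⟩, -⟩, rfl⟩ := ha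
  unfold entrySize
  omega

/-- The composition `α_{ij} = C(D_{ij})` of `lam_i - mu_j - i + j`, for
`mu_j - j ≤ lam_i - i`. It is `(1)` if `mu_j - j + 1 = lam_i - i`, and it is the composition of
`0` if `mu_j - j = lam_i - i`. -/
noncomputable def entryComposition (p : ℤ → StrictWeak) (lam mu : YoungDiagram) (i j : ℕ) :
    Composition (entrySize lam mu i j) :=
  compositionOfSet (entrySize lam mu i j) (entryDescents p lam mu i j)

/-- The entry `L_{α_{ij}}`: it is `0` if `mu_j - j > lam_i - i`, and otherwise the fundamental
quasi-symmetric function of the composition `α_{ij}` (which is `1` if `mu_j - j = lam_i - i`). -/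
noncomputable def entry (p : ℤ → StrictWeak) (lam mu : YoungDiagram) (i j : ℕ) :
    MvPowerSeries ℕ+ ℤ :=
  if rowStart mu j - 1 > rowStop lam i then 0
  else fundamentalQSym (entryComposition p lam mu i j)

/-- The convention `L_{(0)} = 1`: the entry is `1` if `mu_j - j = lam_i - i`. -/
theorem entry_eq_one (p : ℤ → StrictWeak) (lam mu : YoungDiagram) (i j : ℕ)
    (h : rowStart mu j - 1 = rowStop lam i) : entry p lam mu i j = 1 := by
  have h0 : entrySize lam mu i j = 0 := by
    unfold entrySize
    omega
  rw [entry, if_neg (by omega)]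
  generalize entryComposition p lam mu i j = α
  revert α
  rw [h0]
  exact fundamentalQSym_zero

end WaveSchur

/-!
Place a box of a skew shape at its row and its content `j - i`. A partition `lam` then becomes the
strictly decreasing sequence of integers `lam_i - i`, and adding a box to row `i` raises one entry
of this sequence by one. The choice of weak and strict edges amounts to one function `contentKey`
on the contents: an edge of either direction holds exactly when the pair (value, content) does not
go down in the lexicographic order by value and then by key (`row_rel_iff`, `col_rel_iff`).

Restrict the tableaux to those whose pairs (value, content) lie in a finite set, and enlarge this
set by one pair `(k, c)` above all others at a time. The new pair can occur only once, in a box at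
the end of its row and of its column, so that the generating function of the shape `t/s` increases
by `x_k` times that of the shape with the entry `c + 1` of `t` replaced by `c`
(`contentGen_insert_of_eq`). Applied to shapes with one row, the same recurrence holds for the
entries of the determinant, hence, by linearity in the row in question, for the determinant; if the
replacement makes two entries of `t` equal, there is no tableau, and two rows of the determinant
agree. This proves the determinant formula with single-row generating functions as its entries
(`contentGen_eq_det`), without cancelling paths.

The coefficient at `x^d` of both sides sees only finitely many pairs (`coeff_waveSchur`,
`coeff_det_congr`), and the single-row generating functions are the fundamental quasi-symmetric
functions: a weakly increasing sequence is a composition, whose blocks are the maximal constant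
intervals, together with the increasing sequence of its values (`coeff_fundamentalQSym`).
-/

namespace WaveSchur

open Finset Function

/-! ### Tableaux in row and content coordinates -/

/-- The boxes of a skew shape in coordinates (row, content): row `i` occupies the contents `c` with
`s i ≤ c < t i`. A partition `lam` corresponds to the strictly decreasing sequence
`i ↦ lam_i - i`. -/
noncomputable def contentBoxes {m : ℕ} (s t : Fin m → ℤ) : Finset (Fin m × ℤ) :=
  Finset.univ.biUnion fun i => (Finset.Ico (s i) (t i)).image (Prod.mk i)

lemma mem_contentBoxes {m : ℕ} {s t : Fin m → ℤ} {x : Fin m × ℤ} :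
    x ∈ contentBoxes s t ↔ s x.1 ≤ x.2 ∧ x.2 < t x.1 := by
  obtain ⟨i, c⟩ := x
  simp [contentBoxes]

/-- The wave `p`-tableaux `T` of the shape `t/s` in row and content coordinates all of whose pairs
(value, content) lie in `A`. A tableau is extended by the value `1` outside the shape; there is none
unless `t` is strictly decreasing and `s ≤ t`. -/
structure IsContentTableau (p : ℤ → StrictWeak) {m : ℕ} (A : Finset (ℕ+ × ℤ)) (s t : Fin m → ℤ)
    (T : Fin m × ℤ → ℕ+) : Prop where
  anti : StrictAnti t
  le : s ≤ t
  eq_one : ∀ x, x ∉ contentBoxes s t → T x = 1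
  mem : ∀ x ∈ contentBoxes s t, (T x, x.2) ∈ A
  row : ∀ i c, (i, c) ∈ contentBoxes s t → (i, c + 1) ∈ contentBoxes s t →
    (p (c + 1)).Rel (T (i, c)) (T (i, c + 1))
  col : ∀ i j : Fin m, ∀ c, (i : ℕ) + 1 = j → (i, c + 1) ∈ contentBoxes s t →
    (j, c) ∈ contentBoxes s t → (p (c + 1)).bar.Rel (T (i, c + 1)) (T (j, c))

lemma finite_isContentTableau (p : ℤ → StrictWeak) {m : ℕ} (A : Finset (ℕ+ × ℤ))
    (s t : Fin m → ℤ) : {T | IsContentTableau p A s t T}.Finite := by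
  rw [← Set.finite_coe_iff]
  refine Finite.of_injective (β := contentBoxes s t → A)
    (fun T x => ⟨(T.1 x, (x : Fin m × ℤ).2), T.2.mem x x.2⟩) ?_
  intro T T' h
  refine Subtype.ext (funext fun x => ?_)
  by_cases hx : x ∈ contentBoxes s t
  · have := congrArg (fun y : A => y.1.1) (congrFun h ⟨x, hx⟩)
    simpa using this
  · rw [T.2.eq_one x hx, T'.2.eq_one x hx]

/-- The generating function of the tableaux in row and content coordinates with pairs
(value, content) in `A`. -/
noncomputable def contentGen {R : Type*} [CommRing R] (p : ℤ → StrictWeak) (x : ℕ+ → R) {m : ℕ}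
    (A : Finset (ℕ+ × ℤ)) (s t : Fin m → ℤ) : R :=
  ∑ᶠ T ∈ {T | IsContentTableau p A s t T}, ∏ y ∈ contentBoxes s t, x (T y)

/-! ### The order in which boxes are added -/

/-- A function on the contents which increases from `c - 1` to `c` if `p c` is weak, and decreases
if `p c` is strict. Its absolute value is `|c|`, so that the sign can be chosen for one content after
the other, starting from `0` in both directions. It need not be injective: only neighbouring
contents have to be told apart. -/
def contentKey (p : ℤ → StrictWeak) (c : ℤ) : ℤ :=
  if (0 < c ∧ p c = .weak) ∨ (c < 0 ∧ p (c + 1) = .weak) then c else -c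

lemma contentKey_lt_of_weak {p : ℤ → StrictWeak} {c : ℤ} (h : p (c + 1) = .weak) :
    contentKey p c < contentKey p (c + 1) := by
  unfold contentKey
  by_cases hc : 0 ≤ c
  · rw [if_pos (c := 0 < c + 1 ∧ _ ∨ _) (Or.inl ⟨by omega, h⟩)]
    split_ifs <;> omega
  · rw [if_pos (c := 0 < c ∧ _ ∨ _) (Or.inr ⟨by omega, h⟩)]
    split_ifs <;> omega

lemma contentKey_lt_of_strict {p : ℤ → StrictWeak} {c : ℤ} (h : p (c + 1) = .strict) :
    contentKey p (c + 1) < contentKey p c := by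
  unfold contentKey
  by_cases hc : 0 ≤ c
  · rw [if_neg (c := 0 < c + 1 ∧ _ ∨ _) (by simp [h]; omega)]
    split_ifs <;> omega
  · rw [if_neg (c := 0 < c ∧ _ ∨ _) (by simp [h]; omega)]
    split_ifs <;> omega

/-- Pairs (value, content) are ordered by value first, and then by `contentKey`. The
conditions on a tableau say that the position does not go down along any edge, see `row_rel_iff` and
`col_rel_iff`. -/
def position (p : ℤ → StrictWeak) (a : ℕ+ × ℤ) : ℕ+ ×ₗ ℤ :=
  toLex (a.1, contentKey p a.2)

lemma position_le_iff {p : ℤ → StrictWeak} {a b : ℕ+ × ℤ} :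
    position p a ≤ position p b ↔
      a.1 < b.1 ∨ a.1 = b.1 ∧ contentKey p a.2 ≤ contentKey p b.2 := by
  simp [position, Prod.Lex.toLex_le_toLex]

lemma row_rel_iff {p : ℤ → StrictWeak} {c : ℤ} {k l : ℕ+} :
    (p (c + 1)).Rel k l ↔ position p (k, c) ≤ position p (l, c + 1) := by
  rw [position_le_iff]
  cases h : p (c + 1)
  · have := contentKey_lt_of_weak h
    simp only [StrictWeak.Rel, this.le, and_true]
    exact le_iff_lt_or_eq
  · have := contentKey_lt_of_strict h
    simp only [StrictWeak.Rel, this.not_ge, and_false, or_false]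

lemma col_rel_iff {p : ℤ → StrictWeak} {c : ℤ} {k l : ℕ+} :
    (p (c + 1)).bar.Rel k l ↔ position p (k, c + 1) ≤ position p (l, c) := by
  rw [position_le_iff]
  cases h : p (c + 1)
  · have := contentKey_lt_of_weak h
    simp only [StrictWeak.bar, StrictWeak.Rel, this.not_ge, and_false, or_false]
  · have := contentKey_lt_of_strict h
    simp only [StrictWeak.bar, StrictWeak.Rel, this.le, and_true]
    exact le_iff_lt_or_eq

/-- Neighbouring boxes never share a position, so that no box next to one in the maximal position
can come after it. -/
lemma position_ne {p : ℤ → StrictWeak} {c : ℤ} {k l : ℕ+} :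
    position p (k, c) ≠ position p (l, c + 1) := by
  intro h
  have h2 : contentKey p c = contentKey p (c + 1) := congrArg (fun z => (ofLex z).2) h
  cases hp : p (c + 1)
  · exact (contentKey_lt_of_weak hp).ne h2
  · exact (contentKey_lt_of_strict hp).ne' h2

/-! ### Removing the last box -/

lemma strictAnti_update {m : ℕ} {t : Fin m → ℤ} (ht : StrictAnti t) {i : Fin m} {c : ℤ}
    (hi : t i = c + 1) (hc : ∀ j, t j ≠ c) : StrictAnti (update t i c) := by
  intro a b hab
  have h1 := ht hab
  by_cases ha : a = i
  · subst ha
    have := hc b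
    rw [update_self, update_of_ne hab.ne']
    omega
  · rw [update_of_ne ha]
    by_cases hb : b = i
    · subst hb
      rw [update_self]
      omega
    · rwa [update_of_ne hb]

lemma contentBoxes_update {m : ℕ} {s t : Fin m → ℤ} {i : Fin m} {c : ℤ}
    (hi : t i = c + 1) (hs : s i ≤ c) :
    contentBoxes s t = insert (i, c) (contentBoxes s (update t i c)) := by
  ext ⟨j, e⟩
  rw [mem_insert, mem_contentBoxes, mem_contentBoxes, Prod.mk.injEq]
  by_cases hj : j = i
  · subst hj
    simp only [update_self, true_and]
    omega
  · simp only [update_of_ne hj, hj, false_and, false_or]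

lemma notMem_contentBoxes_update {m : ℕ} {s t : Fin m → ℤ} {i : Fin m} {c : ℤ} :
    (i, c) ∉ contentBoxes s (update t i c) := by
  simp [mem_contentBoxes]

section

variable {p : ℤ → StrictWeak} {m : ℕ} {A : Finset (ℕ+ × ℤ)} {a : ℕ+ × ℤ} {s t : Fin m → ℤ}
  {T : Fin m × ℤ → ℕ+}

/-- A box carrying the last pair is the end of its row. -/
lemma IsContentTableau.rowEnd (hmax : ∀ b ∈ A, position p b ≤ position p a)
    (hT : IsContentTableau p (insert a A) s t T) {i : Fin m}
    (hi : (i, a.2) ∈ contentBoxes s t) (hk : T (i, a.2) = a.1) : t i = a.2 + 1 := by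
  by_contra hne
  have hmem := mem_contentBoxes.1 hi
  have hi' : (i, a.2 + 1) ∈ contentBoxes s t := mem_contentBoxes.2 (by dsimp at *; omega)
  have h1 := row_rel_iff.1 (hT.row i a.2 hi hi')
  have h2 : position p (T (i, a.2 + 1), a.2 + 1) ≤ position p a := by
    rcases mem_insert.1 (hT.mem _ hi') with h | h
    · exact (congrArg _ h).le
    · exact hmax _ h
  rw [hk] at h1
  exact position_ne (le_antisymm h1 h2)

/-- A box carrying the last pair is the end of its column, so that no row ends just before it. -/
lemma IsContentTableau.columnEnd (hs : StrictAnti s) (hmax : ∀ b ∈ A, position p b ≤ position p a)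
    (hT : IsContentTableau p (insert a A) s t T) {i : Fin m}
    (hi : (i, a.2) ∈ contentBoxes s t) (hk : T (i, a.2) = a.1) (j : Fin m) : t j ≠ a.2 := by
  intro hj
  have hend := hT.rowEnd hmax hi hk
  have hij : i < j := hT.anti.lt_iff_gt.1 (by omega)
  obtain ⟨i', hi'⟩ : ∃ i' : Fin m, (i : ℕ) + 1 = i' := ⟨⟨i + 1, by omega⟩, rfl⟩
  have hii' : i < i' := by rw [Fin.lt_def]; omega
  have hi'j : i' ≤ j := by rw [Fin.le_def]; rw [Fin.lt_def] at hij; omega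
  have ht1 := hT.anti hii'
  have ht2 := hT.anti.antitone hi'j
  have hs1 := hs hii'
  have hmem := (mem_contentBoxes.1 hi).1
  dsimp only at hmem
  -- Row `i'` is not empty, as `s i' < s i ≤ a.2 = t i'`; its last box lies just below `(i, a.2)`.
  obtain ⟨c, hc⟩ : ∃ c, a.2 = c + 1 := ⟨a.2 - 1, by ring⟩
  have hbelow : (i', c) ∈ contentBoxes s t := mem_contentBoxes.2 (by dsimp only; omega)
  have h1 := hT.col i i' c hi' (hc ▸ hi) hbelow
  rw [← hc, hk] at h1
  have h2 : position p (T (i', c), c) ≤ position p a := by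
    rcases mem_insert.1 (hT.mem _ hbelow) with h | h
    · exact (congrArg _ h).le
    · exact hmax _ h
  rw [hc] at h1
  have h3 := col_rel_iff.1 h1
  have ha : a = (a.1, c + 1) := Prod.ext rfl hc
  rw [ha] at h2
  exact position_ne (le_antisymm h2 h3)

lemma IsContentTableau.mono {B : Finset (ℕ+ × ℤ)} (hAB : A ⊆ B) (hT : IsContentTableau p A s t T) :
    IsContentTableau p B s t T :=
  ⟨hT.anti, hT.le, hT.eq_one, fun x hx => hAB (hT.mem x hx), hT.row, hT.col⟩

lemma IsContentTableau.of_insert (hT : IsContentTableau p (insert a A) s t T)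
    (h : ∀ i, (i, a.2) ∈ contentBoxes s t → T (i, a.2) ≠ a.1) : IsContentTableau p A s t T := by
  refine ⟨hT.anti, hT.le, hT.eq_one, fun x hx => ?_, hT.row, hT.col⟩
  refine (mem_insert.1 (hT.mem x hx)).resolve_left fun he => ?_
  obtain ⟨i, c⟩ := x
  obtain rfl : c = a.2 := congrArg Prod.snd he
  exact h i hx (congrArg Prod.fst he)

/-- Removing the box that carries the last pair. -/
lemma IsContentTableau.remove (hs : StrictAnti s) (hmax : ∀ b ∈ A, position p b ≤ position p a)
    (hT : IsContentTableau p (insert a A) s t T) {i : Fin m}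
    (hi : (i, a.2) ∈ contentBoxes s t) (hk : T (i, a.2) = a.1) :
    IsContentTableau p A s (update t i a.2) (update T (i, a.2) 1) := by
  have hend := hT.rowEnd hmax hi hk
  have hmem := (mem_contentBoxes.1 hi).1
  have hbox := contentBoxes_update hend hmem
  have hsub : ∀ x ∈ contentBoxes s (update t i a.2), x ∈ contentBoxes s t := fun x hx => by
    rw [hbox]; exact mem_insert_of_mem hx
  have hne : ∀ x ∈ contentBoxes s (update t i a.2), x ≠ (i, a.2) := fun x hx he =>
    notMem_contentBoxes_update (he ▸ hx)
  refine ⟨strictAnti_update hT.anti hend (hT.columnEnd hs hmax hi hk), fun j => ?_, fun x hx => ?_,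
    fun x hx => ?_, fun j c h1 h2 => ?_, fun j j' c hj h1 h2 => ?_⟩
  · by_cases hj : j = i
    · subst hj; simpa using hmem
    · rw [update_of_ne hj]; exact hT.le j
  · by_cases he : x = (i, a.2)
    · rw [he, update_self]
    · rw [update_of_ne he]
      refine hT.eq_one x ?_
      rw [hbox, mem_insert, not_or]
      exact ⟨he, hx⟩
  · rw [update_of_ne (hne x hx)]
    refine (mem_insert.1 (hT.mem x (hsub x hx))).resolve_left fun he => ?_
    have hx2 : x.2 = a.2 := congrArg Prod.snd he
    have hx1 : t x.1 = a.2 + 1 := hT.rowEnd hmax (hx2 ▸ hsub x hx)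
      (by rw [← hx2]; exact congrArg Prod.fst he)
    exact hne x hx (Prod.ext (hT.anti.injective (hx1.trans hend.symm)) hx2)
  · rw [update_of_ne (hne _ h1), update_of_ne (hne _ h2)]
    exact hT.row j c (hsub _ h1) (hsub _ h2)
  · rw [update_of_ne (hne _ h1), update_of_ne (hne _ h2)]
    exact hT.col j j' c hj (hsub _ h1) (hsub _ h2)

/-- Adding a box that carries the last pair at the end of a row. -/
lemma IsContentTableau.add (hmax : ∀ b ∈ A, position p b ≤ position p a)
    (ht : StrictAnti t) {i : Fin m} (hi : t i = a.2 + 1)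
    (hT : IsContentTableau p A s (update t i a.2) T) :
    IsContentTableau p (insert a A) s t (update T (i, a.2) a.1) := by
  have hmem : s i ≤ a.2 := by simpa using hT.le i
  have hbox := contentBoxes_update hi hmem
  have hmem_of : ∀ x ∈ contentBoxes s t, x ≠ (i, a.2) → x ∈ contentBoxes s (update t i a.2) :=
    fun x hx he => by
      rw [hbox] at hx
      exact (mem_insert.1 hx).resolve_left he
  refine ⟨ht, fun j => ?_, fun x hx => ?_, fun x hx => ?_, fun j c h1 h2 => ?_,
    fun j j' c hj h1 h2 => ?_⟩
  · by_cases hj : j = i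
    · subst hj
      change s j ≤ t j
      omega
    · have := hT.le j
      rwa [update_of_ne hj] at this
  · rw [hbox, mem_insert, not_or] at hx
    rw [update_of_ne hx.1]
    exact hT.eq_one x hx.2
  · by_cases he : x = (i, a.2)
    · rw [he, update_self]; exact mem_insert_self _ _
    · rw [update_of_ne he]
      exact mem_insert_of_mem (hT.mem x (hmem_of x hx he))
  · have he1 : ((j, c) : Fin m × ℤ) ≠ (i, a.2) := fun he => by
      obtain ⟨rfl, rfl⟩ := Prod.mk.injEq .. ▸ he
      have := (mem_contentBoxes.1 h2).2
      dsimp only at this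
      omega
    have h1' := hmem_of _ h1 he1
    rw [update_of_ne he1]
    by_cases he2 : ((j, c + 1) : Fin m × ℤ) = (i, a.2)
    · have hc : c + 1 = a.2 := congrArg Prod.snd he2
      rw [he2, update_self, row_rel_iff, hc]
      exact hmax _ (hT.mem _ h1')
    · rw [update_of_ne he2]
      exact hT.row j c h1' (hmem_of _ h2 he2)
  · have he1 : ((j, c + 1) : Fin m × ℤ) ≠ (i, a.2) := fun he => by
      have hc : c + 1 = a.2 := congrArg Prod.snd he
      obtain rfl : j = i := congrArg Prod.fst he
      have hjj : j < j' := by rw [Fin.lt_def]; omega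
      have h3 := hT.anti hjj
      have h4 := (mem_contentBoxes.1 h2).2
      rw [update_self, update_of_ne hjj.ne'] at h3
      dsimp only at h4
      omega
    have h1' := hmem_of _ h1 he1
    rw [update_of_ne he1]
    by_cases he2 : ((j', c) : Fin m × ℤ) = (i, a.2)
    · have hc : c = a.2 := congrArg Prod.snd he2
      rw [he2, update_self, col_rel_iff, hc]
      rw [hc] at h1'
      exact hmax _ (hT.mem _ h1')
    · rw [update_of_ne he2]
      exact hT.col j j' c hj h1' (hmem_of _ h2 he2)

end

/-! ### The recurrence for generating functions -/

section

variable {R : Type*} [CommRing R] {p : ℤ → StrictWeak} {x : ℕ+ → R} {m : ℕ}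
  {A : Finset (ℕ+ × ℤ)} {a : ℕ+ × ℤ} {s t : Fin m → ℤ}

/-- If no row of `t` ends with the content of the last pair, this pair does not occur. -/
lemma contentGen_insert_of_forall_ne (hmax : ∀ b ∈ A, position p b ≤ position p a)
    (ht : ∀ i, t i ≠ a.2 + 1) : contentGen p x (insert a A) s t = contentGen p x A s t := by
  unfold contentGen
  congr 1
  funext T
  have : IsContentTableau p (insert a A) s t T ↔ IsContentTableau p A s t T :=
    ⟨fun h => h.of_insert fun i hi hk => ht i (h.rowEnd hmax hi hk),
      fun h => h.mono (subset_insert _ _)⟩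
  simp only [Set.mem_ofPred_eq, this]

/-- If row `i` ends with the content of the last pair, this pair either does not occur, or it occurs
at the end of row `i` only. -/
lemma contentGen_insert_of_eq (hs : StrictAnti s) (ht : StrictAnti t) (ha : a ∉ A)
    (hmax : ∀ b ∈ A, position p b ≤ position p a) {i : Fin m} (hi : t i = a.2 + 1) :
    contentGen p x (insert a A) s t =
      contentGen p x A s t + x a.1 * contentGen p x A s (update t i a.2) := by
  have hset : {T | IsContentTableau p (insert a A) s t T} = {T | IsContentTableau p A s t T} ∪
      (fun T => update T (i, a.2) a.1) '' {T | IsContentTableau p A s (update t i a.2) T} := by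
    ext T
    constructor
    · intro hT
      by_cases hex : ∃ j, (j, a.2) ∈ contentBoxes s t ∧ T (j, a.2) = a.1
      · obtain ⟨j, hj, hk⟩ := hex
        obtain rfl : j = i := ht.injective ((hT.rowEnd hmax hj hk).trans hi.symm)
        refine Or.inr ⟨_, hT.remove hs hmax hj hk, ?_⟩
        simp only [update_idem, ← hk, update_eq_self]
      · exact Or.inl (hT.of_insert fun j hj hk => hex ⟨j, hj, hk⟩)
    · rintro (hT | ⟨T, hT, rfl⟩)
      · exact hT.mono (subset_insert _ _)
      · exact hT.add hmax ht hi
  have hdisj : Disjoint {T | IsContentTableau p A s t T}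
      ((fun T => update T (i, a.2) a.1) '' {T | IsContentTableau p A s (update t i a.2) T}) := by
    rw [Set.disjoint_left]
    rintro _ hT ⟨T, hT', rfl⟩
    have hle : s i ≤ a.2 := by simpa using hT'.le i
    have := hT.mem (i, a.2) (mem_contentBoxes.2 ⟨hle, by dsimp only; omega⟩)
    simp only [update_self] at this
    exact ha this
  have hinj : Set.InjOn (fun T : Fin m × ℤ → ℕ+ => update T (i, a.2) a.1)
      {T | IsContentTableau p A s (update t i a.2) T} := by
    intro T hT T' hT' he
    have h1 := hT.eq_one (i, a.2) notMem_contentBoxes_update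
    have h2 := hT'.eq_one (i, a.2) notMem_contentBoxes_update
    have := congrArg (fun U => update U (i, a.2) 1) he
    simp only [update_idem] at this
    rwa [← h1, update_eq_self, h1, ← h2, update_eq_self] at this
  unfold contentGen
  rw [hset, finsum_mem_union hdisj (finite_isContentTableau ..)
    ((finite_isContentTableau ..).image _), finsum_mem_image hinj,
    ← smul_eq_mul, smul_finsum_mem (finite_isContentTableau ..)]
  congr 1
  refine finsum_mem_congr rfl fun T hT => ?_
  have hle : s i ≤ a.2 := by simpa using hT.le i
  rw [contentBoxes_update hi hle, prod_insert notMem_contentBoxes_update, update_self]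
  congr 1
  refine prod_congr rfl fun y hy => ?_
  rw [update_of_ne]
  rintro rfl
  exact notMem_contentBoxes_update hy

lemma contentGen_of_not_strictAnti (ht : ¬ StrictAnti t) : contentGen p x A s t = 0 := by
  have : {T | IsContentTableau p A s t T} = ∅ :=
    Set.eq_empty_of_forall_notMem fun T hT => ht hT.anti
  rw [contentGen, this, finsum_mem_empty]

lemma contentGen_empty (ht : StrictAnti t) :
    contentGen p x ∅ s t = if s = t then 1 else 0 := by
  split_ifs with h
  · subst h
    have hb : contentBoxes s s = ∅ := eq_empty_of_forall_notMem fun y hy => by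
      have := mem_contentBoxes.1 hy
      omega
    have : {T | IsContentTableau p ∅ s s T} = {fun _ => 1} := by
      ext T
      constructor
      · intro hT
        exact funext fun y => hT.eq_one y (by simp [hb])
      · rintro rfl
        exact ⟨ht, le_rfl, by simp, by simp [hb], by simp [hb], by simp [hb]⟩
    rw [contentGen, this, finsum_mem_singleton, hb, prod_empty]
  · have : {T | IsContentTableau p ∅ s t T} = ∅ := by
      refine Set.eq_empty_of_forall_notMem fun T hT => h (le_antisymm hT.le fun i => ?_)
      by_contra hlt
      have := hT.mem (i, s i) (mem_contentBoxes.2 ⟨le_rfl, by simpa using hlt⟩)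
      simp at this
    rw [contentGen, this, finsum_mem_empty]

end

/-! ### The determinant -/

/-- The generating function of a single row with contents `b, …, e - 1`. -/
noncomputable def rowGen {R : Type*} [CommRing R] (p : ℤ → StrictWeak) (x : ℕ+ → R)
    (A : Finset (ℕ+ × ℤ)) (b e : ℤ) : R :=
  contentGen p x A (fun _ : Fin 1 => b) (fun _ => e)

lemma strictAnti_fin_one (f : Fin 1 → ℤ) : StrictAnti f := fun a b h => by omega

section

variable {R : Type*} [CommRing R] {p : ℤ → StrictWeak} {x : ℕ+ → R}
  {A : Finset (ℕ+ × ℤ)} {a : ℕ+ × ℤ} {b e : ℤ}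

lemma rowGen_empty : rowGen p x ∅ b e = if b = e then 1 else 0 := by
  rw [rowGen, contentGen_empty (strictAnti_fin_one _)]
  simp [funext_iff]

lemma rowGen_insert_of_ne (hmax : ∀ b ∈ A, position p b ≤ position p a) (he : e ≠ a.2 + 1) :
    rowGen p x (insert a A) b e = rowGen p x A b e :=
  contentGen_insert_of_forall_ne hmax fun _ => he

lemma rowGen_insert_of_eq (ha : a ∉ A) (hmax : ∀ b ∈ A, position p b ≤ position p a)
    (he : e = a.2 + 1) :
    rowGen p x (insert a A) b e = rowGen p x A b e + x a.1 * rowGen p x A b a.2 := by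
  have hu : update (fun _ : Fin 1 => e) 0 a.2 = fun _ => a.2 := by
    funext i
    rw [Subsingleton.elim i 0, update_self]
  rw [rowGen, contentGen_insert_of_eq (strictAnti_fin_one _) (strictAnti_fin_one _) ha hmax
    (i := 0) he, hu, rowGen, rowGen]

end

/-- The generating function of the tableaux of shape `t/s` is a determinant of generating functions
of single rows. Both sides satisfy the same recurrence when the pairs (value, content) are admitted
one by one in the order of their positions. -/
theorem contentGen_eq_det {R : Type*} [CommRing R] (p : ℤ → StrictWeak) (x : ℕ+ → R) {m : ℕ}
    (A : Finset (ℕ+ × ℤ)) {s t : Fin m → ℤ} (hs : StrictAnti s) (ht : StrictAnti t) :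
    contentGen p x A s t = (Matrix.of fun i j => rowGen p x A (s j) (t i)).det := by
  induction A using Finset.induction_on_max_value (position p) generalizing t with
  | empty =>
    rw [contentGen_empty ht]
    simp only [rowGen_empty]
    split_ifs with h
    · subst h
      rw [← Matrix.det_one (n := Fin m)]
      congr 1
      ext i j
      simp [Matrix.one_apply, hs.injective.eq_iff, eq_comm]
    · -- Two strictly decreasing sequences of the same length with the same values are equal, so
      -- that some row of the matrix vanishes.
      obtain ⟨i, hi⟩ : ∃ i, ∀ j, s j ≠ t i := by
        by_contra! hcon
        choose σ hσ using hcon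
        have hσm : StrictMono σ := fun i j hij => hs.lt_iff_gt.1 (by rw [hσ, hσ]; exact ht hij)
        refine h (funext fun i => ?_)
        rw [← hσ, hσm.eq_id, id]
      exact (Matrix.det_eq_zero_of_row_eq_zero i fun j => by simp [hi j]).symm
  | insert a A ha hmax ih =>
    by_cases hex : ∃ i, t i = a.2 + 1
    · obtain ⟨i, hi⟩ := hex
      rw [contentGen_insert_of_eq hs ht ha hmax hi, ih ht]
      have hmat : (Matrix.of fun i j => rowGen p x (insert a A) (s j) (t i)) =
          (Matrix.of fun i j => rowGen p x A (s j) (t i)).updateRow i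
            ((Matrix.of fun i j => rowGen p x A (s j) (t i)) i +
              x a.1 • fun j => rowGen p x A (s j) a.2) := by
        ext i' j
        by_cases h : i' = i
        · subst h
          simp [rowGen_insert_of_eq ha hmax hi]
        · rw [Matrix.updateRow_ne h, Matrix.of_apply, Matrix.of_apply,
            rowGen_insert_of_ne hmax fun he => h (ht.injective (he.trans hi.symm))]
      have hmat' : (Matrix.of fun i j => rowGen p x A (s j) (t i)).updateRow i
          (fun j => rowGen p x A (s j) a.2) =
          Matrix.of fun i' j => rowGen p x A (s j) (update t i a.2 i') := by
        ext i' j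
        by_cases h : i' = i
        · subst h; simp
        · simp [Matrix.updateRow_ne h, update_of_ne h]
      rw [hmat, Matrix.det_updateRow_add, Matrix.updateRow_eq_self, Matrix.det_updateRow_smul,
        hmat']
      congr 2
      by_cases hc : ∀ j, t j ≠ a.2
      · exact ih (strictAnti_update ht hi hc)
      · -- Shortening row `i` makes it collide with row `j`: the determinant has two equal rows.
        push Not at hc
        obtain ⟨j, hj⟩ := hc
        have hij : i ≠ j := by rintro rfl; omega
        have heq : update t i a.2 i = update t i a.2 j := by
          rw [update_self, update_of_ne hij.symm, hj]
        rw [contentGen_of_not_strictAnti fun h => hij (h.injective heq)]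
        refine (Matrix.det_zero_of_row_eq hij ?_).symm
        ext j'
        rw [Matrix.of_apply, Matrix.of_apply, heq]
    · push Not at hex
      rw [contentGen_insert_of_forall_ne hmax hex, ih ht]
      congr 1
      ext i j
      exact (rowGen_insert_of_ne hmax (hex i)).symm

/-! ### Fundamental quasi-symmetric functions as sums over sequences -/

section

variable {n : ℕ} (β : Composition n)

lemma index_lt_index_iff {r r' : Fin n} (h : (r : ℕ) + 1 = r') :
    β.index r < β.index r' ↔ (r' : ℕ) ∈ descentSet β := by
  have h1 := β.sizeUpTo_index_le r
  have h2 : (r : ℕ) < β.sizeUpTo (β.index r + 1) := β.lt_sizeUpTo_index_succ r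
  have h1' := β.sizeUpTo_index_le r'
  have h2' : (r' : ℕ) < β.sizeUpTo (β.index r' + 1) := β.lt_sizeUpTo_index_succ r'
  rw [descentSet, mem_image]
  constructor
  · intro hlt
    have h3 : β.sizeUpTo ((β.index r : ℕ) + 1) ≤ β.sizeUpTo (β.index r') :=
      β.monotone_sizeUpTo (by rw [Fin.lt_def] at hlt; omega)
    refine ⟨β.index r + 1, mem_Ioo.2 ⟨by omega, ?_⟩, ?_⟩
    · have := (β.index r').2
      rw [Fin.lt_def] at hlt
      omega
    · omega
  · rintro ⟨k, -, hk⟩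
    by_contra! hcon
    rw [Fin.le_def] at hcon
    rcases Nat.lt_or_ge (β.index r') k with hlt | hge
    · have := β.monotone_sizeUpTo (show (β.index r' : ℕ) + 1 ≤ k from hlt)
      omega
    · have := β.monotone_sizeUpTo (hge.trans hcon)
      omega

lemma index_mono {r r' : Fin n} (h : r ≤ r') : β.index r ≤ β.index r' := by
  by_contra! hcon
  have h1 := β.sizeUpTo_index_le r
  have h2 : (r' : ℕ) < β.sizeUpTo (β.index r' + 1) := β.lt_sizeUpTo_index_succ r'
  have := β.monotone_sizeUpTo (show (β.index r' : ℕ) + 1 ≤ β.index r from hcon)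
  rw [Fin.le_def] at h
  omega

variable {β}

/-- A sequence which rises weakly, and which rises strictly exactly after the ends of the blocks of
`β`, has the same strict inequalities as the block index of `β`. -/
lemma lt_iff_index_lt {f : Fin n → ℕ+}
    (hf : ∀ r r' : Fin n, (r : ℕ) + 1 = r' →
      f r ≤ f r' ∧ (f r < f r' ↔ (r' : ℕ) ∈ descentSet β)) (r r' : Fin n) :
    f r < f r' ↔ β.index r < β.index r' := by
  have key : ∀ k (r r' : Fin n), (r : ℕ) + k = r' →
      f r ≤ f r' ∧ (f r < f r' ↔ β.index r < β.index r') := by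
    intro k
    induction k with
    | zero =>
      intro r r' h
      obtain rfl : r = r' := Fin.ext h
      simp
    | succ k ih =>
      intro r r' h
      obtain ⟨q, hq⟩ : ∃ q : Fin n, (r : ℕ) + k = q := ⟨⟨r + k, by omega⟩, rfl⟩
      have hqr : (q : ℕ) + 1 = r' := by omega
      obtain ⟨h1, h2⟩ := ih r q hq
      obtain ⟨h3, h4⟩ := hf q r' hqr
      rw [← index_lt_index_iff β hqr] at h4
      have h5 := index_mono β (r := r) (r' := q) (by rw [Fin.le_def]; omega)
      have h6 := index_mono β (r := q) (r' := r') (by rw [Fin.le_def]; omega)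
      refine ⟨h1.trans h3, ?_⟩
      have e1 : f r < f r' ↔ f r < f q ∨ f q < f r' := by
        constructor
        · intro hlt
          by_contra! hcon
          exact (hcon.2.trans hcon.1).not_gt hlt
        · rintro (hlt | hlt)
          · exact hlt.trans_le h3
          · exact h1.trans_lt hlt
      have e2 : β.index r < β.index r' ↔ β.index r < β.index q ∨ β.index q < β.index r' := by
        constructor
        · intro hlt
          by_contra! hcon
          exact (hcon.2.trans hcon.1).not_gt hlt
        · rintro (hlt | hlt)
          · exact hlt.trans_le h6
          · exact h5.trans_lt hlt
      rw [e1, e2, h2, h4]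
  rcases le_total r r' with h | h
  · exact (key (r' - r) r r' (by rw [Fin.le_def] at h; omega)).2
  · have h1 := (key (r - r') r' r (by rw [Fin.le_def] at h; omega)).1
    exact iff_of_false h1.not_gt (index_mono β h).not_gt

lemma descentSet_injective : Injective (descentSet : Composition n → Finset ℕ) := by
  intro β γ h
  have hb : β.boundaries = γ.boundaries := by
    ext a
    by_cases h0 : a = 0
    · subst h0
      exact iff_of_true β.toCompositionAsSet.zero_mem γ.toCompositionAsSet.zero_mem
    by_cases h1 : a = Fin.last n
    · subst h1
      exact iff_of_true β.toCompositionAsSet.getLast_mem γ.toCompositionAsSet.getLast_mem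
    have ha0 : 0 < (a : ℕ) := Nat.pos_of_ne_zero fun h => h0 (Fin.ext h)
    have ha1 : (a : ℕ) < n := lt_of_le_of_ne (Nat.lt_succ_iff.1 a.2) fun h => h1 (Fin.ext h)
    have hm : ∀ δ : Composition n, (a : ℕ) ∈ descentSet δ ↔ a ∈ δ.boundaries := fun δ => by
      rw [mem_descentSet]
      refine ⟨fun ⟨_, _, b, hb, he⟩ => Fin.ext he ▸ hb, fun h => ⟨ha0, ha1, a, h, rfl⟩⟩
    rw [← hm, ← hm, h]
  exact (compositionEquiv n).injective (CompositionAsSet.ext hb)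

lemma sum_blocksFun_eq (g : Fin β.length → ℕ+) :
    ∑ b, Finsupp.single (g b) (β.blocksFun b) = ∑ r, Finsupp.single (g (β.index r)) 1 := by
  rw [← β.blocksFinEquiv.sum_comp, Fintype.sum_sigma]
  refine sum_congr rfl fun b _ => ?_
  have : ∀ j, β.index (β.blocksFinEquiv ⟨b, j⟩) = b := fun j => β.index_embedding b j
  simp [this]

end

/-- The coefficients of the fundamental quasi-symmetric function count the weakly increasing
sequences which rise strictly at the descents of the composition. -/
theorem coeff_fundamentalQSym {n : ℕ} (α : Composition n) (d : ℕ+ →₀ ℕ) :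
    MvPowerSeries.coeff d (fundamentalQSym α) =
      (Nat.card {f : Fin n → ℕ+ // (∀ r r' : Fin n, (r : ℕ) + 1 = r' →
        f r ≤ f r' ∧ ((r' : ℕ) ∈ descentSet α → f r < f r')) ∧
          ∑ r, Finsupp.single (f r) 1 = d} : ℤ) := by
  have h1 : MvPowerSeries.coeff d (fundamentalQSym α) =
      (Nat.card (Σ β : {β : Composition n // descentSet α ⊆ descentSet β},
        MonomialSeq β.1 d) : ℤ) := by
    rw [Nat.card_sigma, fundamentalQSym, map_sum, Nat.cast_sum]
    exact Finset.sum_subtype _ (by simp) _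
  have hlt : ∀ (β : Composition n) (i : Fin β.length ↪o ℕ+) (r r' : Fin n), (r : ℕ) + 1 = r' →
      i (β.index r) ≤ i (β.index r') ∧
        (i (β.index r) < i (β.index r') ↔ (r' : ℕ) ∈ descentSet β) := fun β i r r' h => by
    rw [i.le_iff_le, i.lt_iff_lt]
    exact ⟨index_mono β (by rw [Fin.le_def]; omega), index_lt_index_iff β h⟩
  rw [h1]
  congr 1
  refine Nat.card_eq_of_bijective (fun z => ⟨fun r => z.2.1 (z.1.1.index r), fun r r' h => ?_, ?_⟩)
    ⟨?_, ?_⟩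
  · obtain ⟨h2, h3⟩ := hlt z.1.1 z.2.1 r r' h
    exact ⟨h2, fun hm => h3.2 (z.1.2 hm)⟩
  · rw [← sum_blocksFun_eq]
    exact z.2.2
  · rintro ⟨⟨β, hβ⟩, ⟨i, hi⟩⟩ ⟨⟨γ, hγ⟩, ⟨j, hj⟩⟩ he
    have he' : ∀ r, i (β.index r) = j (γ.index r) := congrFun (congrArg Subtype.val he)
    obtain rfl : β = γ := by
      refine descentSet_injective (Finset.ext fun a => ?_)
      by_cases ha : 0 < a ∧ a < n
      · obtain ⟨h0, h1⟩ := ha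
        have h2 := (hlt β i ⟨a - 1, by omega⟩ ⟨a, h1⟩ (by dsimp only; omega)).2
        have h3 := (hlt γ j ⟨a - 1, by omega⟩ ⟨a, h1⟩ (by dsimp only; omega)).2
        rw [he', he'] at h2
        exact h2.symm.trans h3
      · refine iff_of_false (fun h => ha ?_) (fun h => ha ?_) <;>
        · rw [mem_descentSet] at h
          exact ⟨h.1, h.2.1⟩
    obtain rfl : i = j := RelEmbedding.ext fun b => by
      have := he' (β.embedding b ⟨0, β.one_le_blocksFun b⟩)
      rwa [β.index_embedding] at this
    rfl
  · rintro ⟨f, hf, hd⟩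
    -- The blocks of `β` are the maximal intervals on which `f` is constant.
    let D : Finset ℕ := (range n).filter fun a => ∃ r r' : Fin n, (r : ℕ) + 1 = r' ∧ (r' : ℕ) = a ∧
      f r < f r'
    obtain ⟨β, hβ⟩ : ∃ β : Composition n, descentSet β = D :=
      ⟨_, descentSet_compositionOfSet fun a ha => by
        obtain ⟨h1, r, r', h2, h3, -⟩ := mem_filter.1 ha
        exact ⟨by omega, mem_range.1 h1⟩⟩
    have hfβ : ∀ r r' : Fin n, (r : ℕ) + 1 = r' →
        f r ≤ f r' ∧ (f r < f r' ↔ (r' : ℕ) ∈ descentSet β) := by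
      intro r r' h
      refine ⟨(hf r r' h).1, ?_⟩
      rw [hβ, mem_filter, mem_range]
      refine ⟨fun hlt => ⟨r'.2, r, r', h, rfl, hlt⟩, ?_⟩
      rintro ⟨-, q, q', h2, h3, h4⟩
      obtain rfl : q' = r' := Fin.ext h3
      obtain rfl : q = r := Fin.ext (by omega)
      exact h4
    have hidx := lt_iff_index_lt hfβ
    have hsub : descentSet α ⊆ descentSet β := by
      intro a ha
      obtain ⟨h0, h1, -⟩ := (mem_descentSet α a).1 ha
      have hr : ((⟨a - 1, by omega⟩ : Fin n) : ℕ) + 1 = (⟨a, h1⟩ : Fin n) := by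
        dsimp only; omega
      exact (hfβ _ _ hr).2.1 ((hf _ _ hr).2 ha)
    let g : Fin β.length → ℕ+ := fun b => f (β.embedding b ⟨0, β.one_le_blocksFun b⟩)
    have hg : StrictMono g := fun b b' h => by
      rw [hidx, β.index_embedding, β.index_embedding]
      exact h
    have hgf : ∀ r, g (β.index r) = f r := fun r => by
      refine le_antisymm (not_lt.1 fun h => ?_) (not_lt.1 fun h => ?_) <;>
      · rw [hidx, β.index_embedding] at h
        exact h.false
    refine ⟨⟨⟨β, hsub⟩, ⟨OrderEmbedding.ofStrictMono g hg, ?_⟩⟩, ?_⟩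
    · refine (sum_blocksFun_eq g).trans ?_
      simpa only [hgf] using hd
    · exact Subtype.ext (funext hgf)

/-! ### Coefficients of the generating functions of tableaux -/

lemma coeff_contentGen (p : ℤ → StrictWeak) {m : ℕ} (A : Finset (ℕ+ × ℤ)) (s t : Fin m → ℤ)
    (d : ℕ+ →₀ ℕ) :
    MvPowerSeries.coeff d (contentGen p (fun k => (MvPowerSeries.X k : MvPowerSeries ℕ+ ℤ)) A s t) =
      (Nat.card {T : Fin m × ℤ → ℕ+ // IsContentTableau p A s t T ∧
        ∑ y ∈ contentBoxes s t, Finsupp.single (T y) 1 = d} : ℤ) := by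
  have hfin := finite_isContentTableau p A s t
  have hprod : ∀ T : Fin m × ℤ → ℕ+, ∏ y ∈ contentBoxes s t,
      (MvPowerSeries.X (T y) : MvPowerSeries ℕ+ ℤ) =
        MvPowerSeries.monomial (∑ y ∈ contentBoxes s t, Finsupp.single (T y) 1) 1 := fun T => by
    have := MvPowerSeries.prod_monomial (R := ℤ) (fun y => Finsupp.single (T y) 1) (fun _ => 1)
      (contentBoxes s t)
    rwa [prod_const_one] at this
  rw [contentGen, finsum_mem_eq_finite_toFinset_sum _ hfin, map_sum]
  simp only [hprod, MvPowerSeries.coeff_monomial]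
  rw [Finset.sum_boole, Nat.subtype_card]
  intro T
  simp [eq_comm]

/-- If `A` admits all values of weight `d` on all boxes, the coefficient at `x^d` counts the fillings
of the boxes that satisfy the conditions for rows and columns. The boxes may be indexed by any type
`B`. -/
lemma coeff_contentGen_eq_card (p : ℤ → StrictWeak) {m : ℕ} {A : Finset (ℕ+ × ℤ)} {s t : Fin m → ℤ}
    (ht : StrictAnti t) (hst : s ≤ t) {d : ℕ+ →₀ ℕ}
    (hA : ∀ k ∈ d.support, ∀ y ∈ contentBoxes s t, (k, y.2) ∈ A)
    {B : Type*} [Fintype B] (E : B ≃ contentBoxes s t) :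
    MvPowerSeries.coeff d (contentGen p (fun k => (MvPowerSeries.X k : MvPowerSeries ℕ+ ℤ)) A s t) =
      (Nat.card {f : B → ℕ+ //
        ((∀ u v : B, (E u).1.1 = (E v).1.1 → (E u).1.2 + 1 = (E v).1.2 →
          (p (E v).1.2).Rel (f u) (f v)) ∧
        (∀ u v : B, ((E u).1.1 : ℕ) + 1 = (E v).1.1 → (E u).1.2 = (E v).1.2 + 1 →
          (p (E u).1.2).bar.Rel (f u) (f v))) ∧
        ∑ u, Finsupp.single (f u) 1 = d} : ℤ) := by
  have hsum : ∀ T : Fin m × ℤ → ℕ+, ∑ u, Finsupp.single (T (E u).1) 1 =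
      ∑ y ∈ contentBoxes s t, Finsupp.single (T y) 1 := fun T => by
    rw [E.sum_comp (fun y => Finsupp.single (T y.1) 1),
      Finset.sum_coe_sort (contentBoxes s t) (fun y => Finsupp.single (T y) 1)]
  rw [coeff_contentGen]
  congr 1
  refine Nat.card_eq_of_bijective (fun T => ⟨fun u => T.1 (E u).1, ⟨?_, ?_⟩, ?_⟩) ⟨?_, ?_⟩
  · intro u v h1 h2
    have hu : (E u).1 = ((E v).1.1, (E u).1.2) := Prod.ext h1 rfl
    have hv : (E v).1 = ((E v).1.1, (E u).1.2 + 1) := Prod.ext rfl h2.symm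
    have := T.2.1.row (E v).1.1 (E u).1.2 (hu ▸ (E u).2) (hv ▸ (E v).2)
    rwa [← hu, ← hv, h2] at this
  · intro u v h1 h2
    have hu : (E u).1 = ((E u).1.1, (E v).1.2 + 1) := Prod.ext rfl h2
    have := T.2.1.col (E u).1.1 (E v).1.1 (E v).1.2 h1 (hu ▸ (E u).2) (E v).2
    rwa [← hu, ← h2] at this
  · exact (hsum T.1).trans T.2.2
  · rintro ⟨T, hT, hd⟩ ⟨T', hT', hd'⟩ he
    refine Subtype.ext (funext fun y => ?_)
    by_cases hy : y ∈ contentBoxes s t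
    · have := congrFun (congrArg Subtype.val he) (E.symm ⟨y, hy⟩)
      simpa using this
    · exact (hT.eq_one y hy).trans (hT'.eq_one y hy).symm
  · rintro ⟨f, ⟨hrow, hcol⟩, hd⟩
    let T : Fin m × ℤ → ℕ+ := fun y =>
      if hy : y ∈ contentBoxes s t then f (E.symm ⟨y, hy⟩) else 1
    have hT : ∀ y (hy : y ∈ contentBoxes s t), T y = f (E.symm ⟨y, hy⟩) := fun y hy => dif_pos hy
    have hTE : ∀ u, T (E u).1 = f u := fun u => by
      rw [hT _ (E u).2]
      simp
    have hsupp : ∀ u, f u ∈ d.support := fun u => by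
      rw [← hd, Finsupp.mem_support_iff, Finsupp.finsetSum_apply]
      have := Finset.single_le_sum (f := fun u' => (Finsupp.single (f u') 1 : ℕ+ →₀ ℕ) (f u))
        (fun _ _ => Nat.zero_le _) (Finset.mem_univ u)
      rw [Finsupp.single_eq_same] at this
      omega
    refine ⟨⟨T, ⟨ht, hst, fun y hy => dif_neg hy, fun y hy => ?_, fun i c h1 h2 => ?_,
      fun i j c hij h1 h2 => ?_⟩, ?_⟩, Subtype.ext (funext hTE)⟩
    · rw [hT y hy]
      exact hA _ (hsupp _) y hy
    · rw [hT _ h1, hT _ h2]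
      have := hrow (E.symm ⟨_, h1⟩) (E.symm ⟨_, h2⟩)
      simp only [Equiv.apply_symm_apply] at this
      exact this trivial trivial
    · rw [hT _ h1, hT _ h2]
      have := hcol (E.symm ⟨_, h1⟩) (E.symm ⟨_, h2⟩)
      simp only [Equiv.apply_symm_apply] at this
      exact this hij trivial
    · rw [← hsum]
      simpa only [hTE] using hd

/-! ### From Young diagrams to row and content coordinates -/

section

variable {lam mu : YoungDiagram}

lemma strictAnti_rowStart (mu : YoungDiagram) (m : ℕ) :
    StrictAnti fun i : Fin m => rowStart mu i := fun i j h => by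
  have := mu.rowLen_anti i j h.le
  rw [Fin.lt_def] at h
  simp only [rowStart]
  omega

lemma strictAnti_rowStop (lam : YoungDiagram) (m : ℕ) :
    StrictAnti fun i : Fin m => rowStop lam i + 1 := fun i j h => by
  have := lam.rowLen_anti i j h.le
  rw [Fin.lt_def] at h
  simp only [rowStop]
  omega

lemma rowStart_le_rowStop (h : mu ≤ lam) (i : ℕ) : rowStart mu i ≤ rowStop lam i + 1 := by
  have : mu.rowLen i ≤ lam.rowLen i := by
    by_contra! hlt
    exact (YoungDiagram.mem_iff_lt_rowLen.1 (h (YoungDiagram.mem_iff_lt_rowLen.2 hlt))).false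
  simp only [rowStart, rowStop]
  omega

lemma mem_skewCells {x : ℕ × ℕ} :
    x ∈ skewCells lam mu ↔ mu.rowLen x.1 ≤ x.2 ∧ x.2 < lam.rowLen x.1 := by
  obtain ⟨i, j⟩ := x
  rw [skewCells, mem_sdiff, YoungDiagram.mem_cells, YoungDiagram.mem_cells,
    YoungDiagram.mem_iff_lt_rowLen, YoungDiagram.mem_iff_lt_rowLen]
  dsimp only
  omega

lemma lt_colLen_of_mem_skewCells {x : ℕ × ℕ} (hx : x ∈ skewCells lam mu) :
    x.1 < lam.colLen 0 := by
  have := (mem_skewCells.1 hx).2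
  exact YoungDiagram.mem_iff_lt_colLen.1 (YoungDiagram.mem_iff_lt_rowLen.2 (by omega))

/-- The box in row `i` and column `j` has coordinates `(i, j - i)`. -/
noncomputable def skewCellsEquiv (lam mu : YoungDiagram) :
    skewCells lam mu ≃ contentBoxes (fun i : Fin (lam.colLen 0) => rowStart mu i)
      (fun i => rowStop lam i + 1) where
  toFun x := ⟨(⟨x.1.1, lt_colLen_of_mem_skewCells x.2⟩, (x.1.2 : ℤ) - x.1.1), by
    have := mem_skewCells.1 x.2
    rw [mem_contentBoxes]
    simp only [rowStart, rowStop]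
    omega⟩
  invFun y := ⟨(y.1.1, (y.1.2 + (y.1.1 : ℕ)).toNat), by
    have := mem_contentBoxes.1 y.2
    simp only [rowStart, rowStop] at this
    rw [mem_skewCells]
    dsimp only
    omega⟩
  left_inv x := Subtype.ext (Prod.ext rfl (by dsimp only; omega))
  right_inv y := Subtype.ext (Prod.ext rfl (by
    have := mem_contentBoxes.1 y.2
    simp only [rowStart, rowStop] at this
    dsimp only
    omega))

lemma isWaveTableau_iff {p : ℤ → StrictWeak} {T : skewCells lam mu → ℕ+} :
    IsWaveTableau p lam mu T ↔
      (∀ u v : skewCells lam mu, u.1.1 = v.1.1 → u.1.2 + 1 = v.1.2 →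
        (p ((v.1.2 : ℤ) - v.1.1)).Rel (T u) (T v)) ∧
      (∀ u v : skewCells lam mu, u.1.1 + 1 = v.1.1 → u.1.2 = v.1.2 →
        (p ((u.1.2 : ℤ) - u.1.1)).bar.Rel (T u) (T v)) := by
  constructor
  · intro hT
    refine ⟨fun u v h1 h2 => ?_, fun u v h1 h2 => ?_⟩
    · have := hT u v (Prod.covBy_iff.2 (Or.inr ⟨Nat.covBy_iff_add_one_eq.2 h2, h1⟩))
      rwa [edgeLabel, if_pos h1] at this
    · have := hT u v (Prod.covBy_iff.2 (Or.inl ⟨Nat.covBy_iff_add_one_eq.2 h1, h2⟩))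
      rw [edgeLabel, if_neg (by omega)] at this
      convert this using 4
      omega
  · rintro ⟨hrow, hcol⟩ u v huv
    rcases Prod.covBy_iff.1 huv with ⟨h1, h2⟩ | ⟨h2, h1⟩
    · rw [Nat.covBy_iff_add_one_eq] at h1
      rw [edgeLabel, if_neg (by omega)]
      convert hcol u v h1 h2 using 4
      omega
    · rw [Nat.covBy_iff_add_one_eq] at h2
      rw [edgeLabel, if_pos h1]
      exact hrow u v h1 h2

lemma coeff_waveSchur (p : ℤ → StrictWeak) (h : mu ≤ lam) {A : Finset (ℕ+ × ℤ)} {d : ℕ+ →₀ ℕ}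
    (hA : ∀ k ∈ d.support, ∀ y ∈ contentBoxes (fun i : Fin (lam.colLen 0) => rowStart mu i)
      (fun i => rowStop lam i + 1), (k, y.2) ∈ A) :
    MvPowerSeries.coeff d (waveSchur p lam mu) =
      MvPowerSeries.coeff d (contentGen p (fun k => (MvPowerSeries.X k : MvPowerSeries ℕ+ ℤ)) A
        (fun i : Fin (lam.colLen 0) => rowStart mu i) (fun i => rowStop lam i + 1)) := by
  rw [coeff_contentGen_eq_card p (strictAnti_rowStop lam _) (fun i => rowStart_le_rowStop h i) hA
    (skewCellsEquiv lam mu)]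
  change (Nat.card (WaveTableau p lam mu d) : ℤ) = _
  congr 1
  refine Nat.card_congr (Equiv.subtypeEquivRight fun T => and_congr ?_ Iff.rfl)
  rw [isWaveTableau_iff]
  simp only [skewCellsEquiv, Equiv.coe_fn_mk, Fin.mk.injEq]
  refine and_congr (forall₂_congr fun u v => ?_) (forall₂_congr fun u v => ?_)
  · refine forall_congr' fun h1 => imp_congr ?_ Iff.rfl
    omega
  · refine forall_congr' fun h1 => imp_congr ?_ Iff.rfl
    omega

end

/-! ### The entries of the determinant -/

/-- The boxes of a single row. -/
noncomputable def rowEquiv (b e : ℤ) {N : ℕ} (h : b + N = e) :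
    Fin N ≃ contentBoxes (fun _ : Fin 1 => b) (fun _ => e) where
  toFun r := ⟨(0, b + (r : ℕ)), by rw [mem_contentBoxes]; dsimp only; omega⟩
  invFun y := ⟨(y.1.2 - b).toNat, by
    have := mem_contentBoxes.1 y.2
    omega⟩
  left_inv r := Fin.ext (by dsimp only; omega)
  right_inv y := Subtype.ext (Prod.ext (Subsingleton.elim _ _) (by
    have := mem_contentBoxes.1 y.2
    dsimp only
    omega))

lemma mem_entryDescents_iff {p : ℤ → StrictWeak} {lam mu : YoungDiagram} {i j r : ℕ} (h0 : 0 < r)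
    (hr : r < entrySize lam mu i j) :
    r ∈ entryDescents p lam mu i j ↔ p (rowStart mu j + r) = .strict := by
  simp only [entryDescents, mem_image, mem_filter, mem_Ioc]
  constructor
  · rintro ⟨a, ⟨⟨h1, h2⟩, h3⟩, rfl⟩
    rwa [show rowStart mu j + ((a - rowStart mu j).toNat : ℤ) = a by omega]
  · intro h
    refine ⟨rowStart mu j + r, ⟨⟨by omega, ?_⟩, h⟩, by omega⟩
    unfold entrySize at hr
    omega

lemma coeff_entry (p : ℤ → StrictWeak) (lam mu : YoungDiagram) (i j : ℕ) {A : Finset (ℕ+ × ℤ)}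
    {d : ℕ+ →₀ ℕ}
    (hA : ∀ k ∈ d.support, ∀ c, rowStart mu j ≤ c → c < rowStop lam i + 1 → (k, c) ∈ A) :
    MvPowerSeries.coeff d (entry p lam mu i j) =
      MvPowerSeries.coeff d (rowGen p (fun k => (MvPowerSeries.X k : MvPowerSeries ℕ+ ℤ)) A
        (rowStart mu j) (rowStop lam i + 1)) := by
  unfold entry
  split_ifs with h
  · have : {T | IsContentTableau p A (fun _ : Fin 1 => rowStart mu j)
        (fun _ => rowStop lam i + 1) T} = ∅ :=
      Set.eq_empty_of_forall_notMem fun T hT => by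
        have := hT.le 0
        dsimp only at this
        omega
    rw [rowGen, contentGen, this, finsum_mem_empty]
  · have hN : rowStart mu j + (entrySize lam mu i j : ℤ) = rowStop lam i + 1 := by
      unfold entrySize
      omega
    rw [rowGen, coeff_contentGen_eq_card p (strictAnti_fin_one _) (fun _ => by
        change rowStart mu j ≤ rowStop lam i + 1
        omega)
      (fun k hk y hy => hA k hk _ (mem_contentBoxes.1 hy).1 (mem_contentBoxes.1 hy).2)
      (rowEquiv _ _ hN), coeff_fundamentalQSym]
    congr 1
    refine Nat.card_congr (Equiv.subtypeEquivRight fun f => and_congr ?_ Iff.rfl)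
    rw [entryComposition, descentSet_compositionOfSet (entryDescents_bounds p lam mu i j)]
    have hrel : ∀ r r' : Fin (entrySize lam mu i j), (r : ℕ) + 1 = r' →
        ((f r ≤ f r' ∧ ((r' : ℕ) ∈ entryDescents p lam mu i j → f r < f r')) ↔
          (p (rowStart mu j + (r' : ℕ))).Rel (f r) (f r')) := by
      intro r r' h
      rw [mem_entryDescents_iff (by omega) r'.2]
      cases p (rowStart mu j + (r' : ℕ))
      · simp [StrictWeak.Rel]
      · simpa [StrictWeak.Rel] using le_of_lt
    simp only [rowEquiv, Equiv.coe_fn_mk]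
    constructor
    · intro hf
      refine ⟨fun u v _ h => ?_, fun u v h => ?_⟩
      · have huv : (u : ℕ) + 1 = v := by omega
        exact (hrel u v huv).1 (hf u v huv)
      · simp at h
    · rintro ⟨hf, -⟩ u v h
      exact (hrel u v h).2 (hf u v trivial (by omega))

/-! ### Congruence of power series -/

/-- The ideal of the power series without terms dividing `x^d`. -/
def truncationIdeal {σ R : Type*} [CommRing R] (d : σ →₀ ℕ) : Ideal (MvPowerSeries σ R) where
  carrier := {f | ∀ e ≤ d, MvPowerSeries.coeff e f = 0}
  add_mem' hf hg e he := by rw [map_add, hf e he, hg e he, add_zero]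
  zero_mem' e _ := map_zero _
  smul_mem' g f hf e he := by
    classical
    rw [smul_eq_mul, MvPowerSeries.coeff_mul]
    refine sum_eq_zero fun z hz => ?_
    have := mem_antidiagonal.1 hz
    rw [hf z.2 (le_trans (this ▸ le_add_self) he), mul_zero]

/-- The coefficient of a determinant at `x^d` depends only on the coefficients of the entries at the
divisors of `x^d`. -/
lemma coeff_det_congr {σ R n : Type*} [CommRing R] [Fintype n] [DecidableEq n] {d : σ →₀ ℕ}
    {M N : Matrix n n (MvPowerSeries σ R)}
    (h : ∀ i j, ∀ e ≤ d, MvPowerSeries.coeff e (M i j) = MvPowerSeries.coeff e (N i j)) :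
    MvPowerSeries.coeff d M.det = MvPowerSeries.coeff d N.det := by
  have hmap : M.map (Ideal.Quotient.mk (truncationIdeal (R := R) d)) =
      N.map (Ideal.Quotient.mk (truncationIdeal d)) := by
    ext i j
    rw [Matrix.map_apply, Matrix.map_apply, Ideal.Quotient.eq]
    intro e he
    rw [map_sub, h i j e he, sub_self]
  have hdet : Ideal.Quotient.mk (truncationIdeal (R := R) d) M.det =
      Ideal.Quotient.mk (truncationIdeal d) N.det := by
    rw [RingHom.map_det, RingHom.map_det, RingHom.mapMatrix_apply, RingHom.mapMatrix_apply, hmap]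
  have := Ideal.Quotient.eq.1 hdet d le_rfl
  rwa [map_sub, sub_eq_zero] at this

end WaveSchur

open WaveSchur in
theorem theorem6p3 (p : ℤ → StrictWeak) (lam mu : YoungDiagram) (h : mu ≤ lam) :
    WaveSchur.waveSchur p lam mu =
      Matrix.det (Matrix.of fun i j : Fin (lam.colLen 0) =>
        WaveSchur.entry p lam mu i j) := by
  ext d
  -- Only the values in the support of `d` matter, on all contents that occur in an entry.
  let A : Finset (ℕ+ × ℤ) := d.support ×ˢ Finset.univ.biUnion fun i : Fin (lam.colLen 0) =>
    Finset.univ.biUnion fun j : Fin (lam.colLen 0) =>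
      Finset.Ico (rowStart mu j) (rowStop lam i + 1)
  have hA : ∀ k ∈ d.support, ∀ (i j : Fin (lam.colLen 0)) (c : ℤ), rowStart mu j ≤ c →
      c < rowStop lam i + 1 → (k, c) ∈ A := fun k hk i j c h1 h2 =>
    Finset.mem_product.2 ⟨hk, Finset.mem_biUnion.2 ⟨i, Finset.mem_univ i, Finset.mem_biUnion.2
      ⟨j, Finset.mem_univ j, Finset.mem_Ico.2 ⟨h1, h2⟩⟩⟩⟩
  rw [coeff_waveSchur p h fun k hk y hy => hA k hk y.1 y.1 y.2 (mem_contentBoxes.1 hy).1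
    (mem_contentBoxes.1 hy).2, contentGen_eq_det p _ A (strictAnti_rowStart mu _)
    (strictAnti_rowStop lam _)]
  refine coeff_det_congr fun i j e he => ?_
  rw [Matrix.of_apply, Matrix.of_apply]
  exact (coeff_entry p lam mu i j fun k hk c => hA k (Finsupp.support_mono he hk) i j c).symm
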